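/- For a field $K$ let $\mathrm{Cr}_2(K)$ be the planar Cremona group, i.e. the group of birational transformations of the affine plane over $K$ (equivalently, up to passing to the opposite group, the group of $K$-automorphisms of $K(x,y)$). For $t\in K$, $f\in K(X)$ and $g\in K(X)^\times$ let $s_t,\alpha_f,\mu_g\in\mathrm{Cr}_2(K)$ be given by $$s_t(x,y)=(x+t,y),\qquad \alpha_f(x,y)=(x,y+f(x)),\qquad \mu_g(x,y)=(x,y\,g(x)).$$ Let $G\subset\mathrm{Cr}_2(\mathbf{Q})$ be the subgroup generated by $s_1:(x,y)\mapsto(x+1,y)$, $\alpha_1:(x,y)\mapsto(x,y+1)$ and $\mu_X:(x,y)\mapsto(x,xy)$, and for each integer $n\ge 0$ let $\Gamma_n\subset\mathrm{Cr}_2(\mathbf{Q})$ be the subgroup generated by $s_1$ and $\alpha_{X^n}:(x,y)\mapsto(x,y+x^n)$. Then: 1. The finitely generated group $G$ is solvable of derived length exactly three. 2. $G$ has no faithful finite-dimensional linear representation over any field. 3. For every $n\ge 0$, $\Gamma_n$ is a subgroup of $G$, is torsion-free, and is nilpotent of class exactly $n+1$. 4. In contrast, for every integer $d\ge 0$ there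 is an integer $c$ such that, for every field $F$, every torsion-free nilpotent subgroup of $\mathrm{GL}_d(F)$ has nilpotency class at most $c$. -/

import Mathlib

noncomputable section

namespace Cremona

/-- The field `K(x, y)` of rational functions in two variables. -/
abbrev RatField (K : Type*) [Field K] : Type _ := FractionRing (MvPolynomial (Fin 2) K)

/-- The first coordinate `x` as an element of `K(x, y)`. -/
def x (K : Type*) [Field K] : RatField K :=
  algebraMap (MvPolynomial (Fin 2) K) (RatField K) (MvPolynomial.X 0)

/-- The second coordinate `y` as an element of `K(x, y)`. -/
def y (K : Type*) [Field K] : RatField K :=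
  algebraMap (MvPolynomial (Fin 2) K) (RatField K) (MvPolynomial.X 1)

/-- The planar Cremona group `Cr₂(K)`: the birational transformations of the affine plane over
`K`. A birational transformation `φ` is identified with its comorphism `h ↦ h ∘ φ`, a
`K`-automorphism of `K(x, y)`. As `h ↦ h ∘ (φ ∘ ψ)` is the comorphism of `φ` followed by that of
`ψ`, composition of transformations is multiplication in the opposite of the automorphism
group. -/
abbrev Cr₂ (K : Type*) [Field K] : Type _ := (RatField K ≃ₐ[K] RatField K)ᵐᵒᵖ

section coordinates

variable {K : Type*} [Field K]

theorem isTranscendenceBasis_coord :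
    IsTranscendenceBasis K (fun i : Fin 2 =>
      algebraMap (MvPolynomial (Fin 2) K) (RatField K) (MvPolynomial.X i)) :=
  have : Algebra.IsAlgebraic (MvPolynomial (Fin 2) K) (RatField K) :=
    IsLocalization.isAlgebraic _ (nonZeroDivisors (MvPolynomial (Fin 2) K))
  (IsTranscendenceBasis.mvPolynomial (Fin 2) K).algebraMap_comp

theorem x_ne_zero : x K ≠ 0 := isTranscendenceBasis_coord.1.ne_zero 0

theorem adjoin_x_y : IntermediateField.adjoin K {x K, y K} = ⊤ := by
  rw [eq_top_iff]
  rintro z -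
  obtain ⟨p, q, -, rfl⟩ := IsFractionRing.div_surjective (A := MvPolynomial (Fin 2) K) z
  have key : ∀ p : MvPolynomial (Fin 2) K, algebraMap _ (RatField K) p ∈
      IntermediateField.adjoin K {x K, y K} := by
    intro p
    induction p using MvPolynomial.induction_on with
    | C a =>
      have h : algebraMap (MvPolynomial (Fin 2) K) (RatField K) (MvPolynomial.C a)
          = algebraMap K (RatField K) a := by
        rw [IsScalarTower.algebraMap_apply K (MvPolynomial (Fin 2) K) (RatField K)]
        rfl
      rw [h]
      exact IntermediateField.algebraMap_mem _ a
    | add p q hp hq => rw [map_add]; exact add_mem hp hq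
    | mul_X p i hp =>
      rw [map_mul]
      refine mul_mem hp (IntermediateField.subset_adjoin K _ ?_)
      fin_cases i
      · exact Or.inl rfl
      · exact Or.inr rfl
  exact div_mem (key p) (key q)

/-- Two generators of the field `K(x, y)` over `K` are algebraically independent. -/
theorem algebraicIndependent_of_adjoin_eq_top (u : Fin 2 → RatField K)
    (hu : IntermediateField.adjoin K (Set.range u) = ⊤) : AlgebraicIndependent K u := by
  have halg : Algebra.IsAlgebraic (Algebra.adjoin K (Set.range u)) (RatField K) := by
    refine ⟨fun z => ?_⟩
    have hz : z ∈ IntermediateField.adjoin K (Set.range u) := hu ▸ IntermediateField.mem_top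
    obtain ⟨p, hp, q, hq, rfl⟩ := IntermediateField.mem_adjoin_iff_div.1 hz
    rw [div_eq_mul_inv]
    exact (isAlgebraic_algebraMap (⟨p, hp⟩ : Algebra.adjoin K (Set.range u))).mul
      (isAlgebraic_algebraMap (⟨q, hq⟩ : Algebra.adjoin K (Set.range u))).inv
  refine (Algebra.IsAlgebraic.isTranscendenceBasis_of_lift_le_trdeg_of_finite K u ?_).1
  rw [← (isTranscendenceBasis_coord (K := K)).lift_cardinalMk_eq_trdeg]

end coordinates

/-- The birational transformation `(x, y) ↦ (u₀(x, y), u₁(x, y))`, for `u₀, u₁` generating the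
field `K(x, y)` over `K`; its comorphism sends `x` to `u₀` and `y` to `u₁`. -/
def birational {K : Type*} [Field K] (u₀ u₁ : RatField K)
    (hu : IntermediateField.adjoin K {u₀, u₁} = ⊤) : Cr₂ K :=
  have hr : IntermediateField.adjoin K (Set.range ![u₀, u₁]) = ⊤ := by
    rw [Matrix.range_cons_cons_empty]; exact hu
  MulOpposite.op
    ((algebraicIndependent_of_adjoin_eq_top ![u₀, u₁] hr).aevalEquivField.trans
      ((IntermediateField.equivOfEq hr).trans IntermediateField.topEquiv))

section birational

variable {K : Type*} [Field K] (u₀ u₁ : RatField K)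
  (hu : IntermediateField.adjoin K {u₀, u₁} = ⊤)

@[simp] theorem birational_x : (birational u₀ u₁ hu).unop (x K) = u₀ := by
  simp [birational, x]

@[simp] theorem birational_y : (birational u₀ u₁ hu).unop (y K) = u₁ := by
  simp [birational, y]

/-- A birational transformation is determined by its two coordinates. -/
theorem Cr₂.ext {φ ψ : Cr₂ K} (hx : φ.unop (x K) = ψ.unop (x K))
    (hy : φ.unop (y K) = ψ.unop (y K)) : φ = ψ := by
  apply MulOpposite.unop_injective
  apply AlgEquiv.coe_toAlgHom_injective
  apply IsLocalization.algHom_ext (nonZeroDivisors (MvPolynomial (Fin 2) K))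
  apply MvPolynomial.algHom_ext
  intro i
  fin_cases i
  · exact hx
  · exact hy

end birational

/-- The evaluation `f ↦ f(x)`, from `K(X)` to `K(x, y)`. -/
def atX (K : Type*) [Field K] : RatFunc K →ₐ[K] RatField K :=
  RatFunc.liftAlgHom (Polynomial.aeval (x K)) (nonZeroDivisors_le_comap_nonZeroDivisors_of_injective
    _ (transcendental_iff_injective.1 (isTranscendenceBasis_coord.1.transcendental 0)))

section generation

variable {K : Type*} [Field K]

@[simp] theorem atX_algebraMap (p : Polynomial K) :
    atX K (algebraMap (Polynomial K) (RatFunc K) p) = Polynomial.aeval (x K) p := by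
  simp [atX, RatFunc.liftAlgHom_apply]

theorem atX_mem (E : IntermediateField K (RatField K)) (hE : x K ∈ E) (f : RatFunc K) :
    atX K f ∈ E := by
  have key : ∀ p : Polynomial K, Polynomial.aeval (x K) p ∈ E := fun p => by
    rw [Polynomial.aeval_eq_sum_range]
    exact sum_mem fun i _ => E.smul_mem (pow_mem hE i)
  rw [← RatFunc.num_div_denom f, map_div₀, atX_algebraMap, atX_algebraMap]
  exact div_mem (key _) (key _)

theorem adjoin_eq_top {u₀ u₁ : RatField K} (hx : x K ∈ IntermediateField.adjoin K {u₀, u₁})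
    (hy : y K ∈ IntermediateField.adjoin K {u₀, u₁}) :
    IntermediateField.adjoin K {u₀, u₁} = ⊤ := by
  rw [eq_top_iff, ← adjoin_x_y, IntermediateField.adjoin_le_iff]
  rintro z (rfl | rfl)
  · exact hx
  · exact hy

theorem adjoin_s (t : K) :
    IntermediateField.adjoin K {x K + algebraMap K (RatField K) t, y K} = ⊤ := by
  apply adjoin_eq_top
  · have h := sub_mem
      (IntermediateField.subset_adjoin K {x K + algebraMap K (RatField K) t, y K} (Or.inl rfl))
      (IntermediateField.algebraMap_mem _ t)
    rwa [add_sub_cancel_right] at h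
  · exact IntermediateField.subset_adjoin K _ (Or.inr rfl)

theorem adjoin_α (f : RatFunc K) :
    IntermediateField.adjoin K {x K, y K + atX K f} = ⊤ := by
  have hx : x K ∈ IntermediateField.adjoin K {x K, y K + atX K f} :=
    IntermediateField.subset_adjoin K _ (Or.inl rfl)
  apply adjoin_eq_top hx
  have h := sub_mem (IntermediateField.subset_adjoin K {x K, y K + atX K f} (Or.inr rfl))
    (atX_mem _ hx f)
  rwa [add_sub_cancel_right] at h

theorem adjoin_μ (g : (RatFunc K)ˣ) :
    IntermediateField.adjoin K {x K, y K * atX K (g : RatFunc K)} = ⊤ := by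
  have hx : x K ∈ IntermediateField.adjoin K {x K, y K * atX K (g : RatFunc K)} :=
    IntermediateField.subset_adjoin K _ (Or.inl rfl)
  apply adjoin_eq_top hx
  have h := div_mem
    (IntermediateField.subset_adjoin K {x K, y K * atX K (g : RatFunc K)} (Or.inr rfl))
    (atX_mem _ hx (g : RatFunc K))
  rwa [mul_div_cancel_right₀ _ ((map_ne_zero (atX K)).2 g.ne_zero)] at h

end generation

section generators

variable {K : Type*} [Field K]

/-- The translation `s_t : (x, y) ↦ (x + t, y)`. -/
def s (t : K) : Cr₂ K := birational (x K + algebraMap K (RatField K) t) (y K) (adjoin_s t)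

/-- The transformation `α_f : (x, y) ↦ (x, y + f(x))`, for `f ∈ K(X)`. -/
def α (f : RatFunc K) : Cr₂ K := birational (x K) (y K + atX K f) (adjoin_α f)

/-- The transformation `μ_g : (x, y) ↦ (x, y g(x))`, for `g ∈ K(X)ˣ`. -/
def μ (g : (RatFunc K)ˣ) : Cr₂ K := birational (x K) (y K * atX K (g : RatFunc K)) (adjoin_μ g)

end generators

/-- The subgroup `G` of `Cr₂(ℚ)` generated by `s₁`, `α₁` and `μ_X`. -/
def G : Subgroup (Cr₂ ℚ) :=
  Subgroup.closure {s 1, α 1, μ (Units.mk0 RatFunc.X RatFunc.X_ne_zero)}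

/-- The subgroup `Γ_n` of `Cr₂(K)` generated by `s₁` and `α_{X^n}`. -/
def Γ (K : Type*) [Field K] (n : ℕ) : Subgroup (Cr₂ K) :=
  Subgroup.closure {s 1, α (RatFunc.X ^ n)}

end Cremona

end

/-!
The groups `Γ_n` have unbounded nilpotency class, whereas for linear groups there is a bound:
a torsion-free nilpotent subgroup `N` of `GL_d(F)` has class at most `d`. As `G` contains every
`Γ_n`, it is not linear.

*Linear groups.* One may take `F` algebraically closed. On an irreducible factor of the
representation of `N`, central elements are scalars, and a commutator that is a scalar has
determinant one, so the centre of the image modulo scalars has exponent dividing the dimension; a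
nilpotent group whose centre has finite exponent is a torsion group
(`isOfFinOrder_of_forall_center_pow_eq_one`), so every element has a power acting as a scalar.
Along a composition series (`Representation.exists_flag`), the elements of `N` acting by scalars
on all factors therefore form a subgroup `H` that contains a power of every element of `N`. In a
torsion-free nilpotent group an element commuting with a power of `g` commutes with `g`, also
modulo the terms of the upper central series, and so `N` has the class of `H`
(`nilpotencyClass_le_of_forall_pow_mem`). Finally `H` is triangular, and its lower central series
descends along the flag (`lowerCentralSeries_scalarSubgroup_le`): on the operators induced by
`u - 1` between two factors, `u ↦ ⁅u, h⁆` acts as multiplication by a scalar, which is nilpotent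
because `N` is, hence zero.

*The Cremona side.* The elements of `G` have the form `(x, y) ↦ (x + t, a(x) y + b(x))`. Successive
commutators kill the translation `t`, then the factor `a`, then everything; the second derived
subgroup contains the commutator of `y ↦ y (x - 1) / x` and `y ↦ y + 1 - x`, which is not trivial.
The elements of `Γ_n` have the form `(x, y) ↦ (x + t, y + p(x))` with `deg p ≤ n`. A commutator
lowers the degree of `p`, and commutation with `s₁` replaces `p` by a finite difference, which
lowers the degree by exactly one in characteristic zero.
-/

open scoped commutatorElement

/-! ### Roots in torsion-free nilpotent groups -/

section NilpotentGroups

variable {N : Type*} [Group N]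

/-- In a nilpotent group, an exponent of the centre bounds every order: the centre of `N ⧸ Z(N)`
has the same exponent, because `⁅g, h⁆ ^ n = ⁅g ^ n, h⁆` for `g` central modulo the centre. -/
theorem isOfFinOrder_of_forall_center_pow_eq_one [Group.IsNilpotent N] {n : ℕ} (hn : 0 < n)
    (h : ∀ z ∈ Subgroup.center N, z ^ n = 1) (g : N) : IsOfFinOrder g := by
  revert h g
  refine Group.nilpotent_center_quotient_ind
    (P := fun G _ _ => (∀ z ∈ Subgroup.center G, z ^ n = 1) → ∀ g : G, IsOfFinOrder g) N ?_ ?_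
  · intro G _ _ _ g
    rw [Subsingleton.elim g 1]
    exact IsOfFinOrder.one
  · intro G _ _ ih h g
    have key : ∀ z ∈ Subgroup.center (G ⧸ Subgroup.center G), z ^ n = 1 := by
      intro z
      induction z using QuotientGroup.induction_on with
      | H z =>
      intro hz
      have hz' : ∀ k : G, ⁅k, z⁆ ∈ Subgroup.center G := by
        intro k
        rw [← QuotientGroup.eq_one_iff, ← QuotientGroup.coe_mk', map_commutatorElement,
          commutatorElement_eq_one_iff_mul_comm]
        exact Subgroup.mem_center_iff.1 hz _
      rw [← QuotientGroup.mk_pow, QuotientGroup.eq_one_iff, Subgroup.mem_center_iff]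
      intro k
      have hc := Subgroup.mem_center_iff.1 (hz' k) z
      have e : k * z * k⁻¹ = ⁅k, z⁆ * z := by simp [commutatorElement_def]
      have e2 : k * z ^ n * k⁻¹ = z ^ n := by
        rw [← conj_pow, e, Commute.mul_pow hc.symm, h _ (hz' k), one_mul]
      exact mul_inv_eq_iff_eq_mul.1 e2
    obtain ⟨m, hm, hgm⟩ := (isOfFinOrder_iff_pow_eq_one).1 (ih key (g : G ⧸ Subgroup.center G))
    rw [← QuotientGroup.mk_pow, QuotientGroup.eq_one_iff] at hgm
    refine isOfFinOrder_iff_pow_eq_one.2 ⟨m * n, Nat.mul_pos hm hn, ?_⟩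
    rw [pow_mul, h _ hgm]

/-- If the centre of `N` is torsion-free, then so is the centre of `N ⧸ Z(N)`. -/
theorem eq_one_of_mem_center_quotient_center
    (h : ∀ z ∈ Subgroup.center N, IsOfFinOrder z → z = 1) :
    ∀ z ∈ Subgroup.center (N ⧸ Subgroup.center N), IsOfFinOrder z → z = 1 := by
  intro z
  induction z using QuotientGroup.induction_on with
  | H z =>
  intro hz hfin
  obtain ⟨n, hn, hzn⟩ := isOfFinOrder_iff_pow_eq_one.1 hfin
  rw [← QuotientGroup.mk_pow, QuotientGroup.eq_one_iff] at hzn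
  have hz' : ∀ k : N, ⁅k, z⁆ ∈ Subgroup.center N := by
    intro k
    rw [← QuotientGroup.eq_one_iff, ← QuotientGroup.coe_mk', map_commutatorElement,
      commutatorElement_eq_one_iff_mul_comm]
    exact Subgroup.mem_center_iff.1 hz _
  rw [QuotientGroup.eq_one_iff, Subgroup.mem_center_iff]
  intro k
  have hc := Subgroup.mem_center_iff.1 (hz' k) z
  have e : k * z * k⁻¹ = ⁅k, z⁆ * z := by simp [commutatorElement_def]
  have e2 : ⁅k, z⁆ ^ n = 1 := by
    have : k * z ^ n * k⁻¹ = z ^ n := by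
      rw [Subgroup.mem_center_iff.1 hzn k, mul_inv_cancel_right]
    rw [← conj_pow, e, Commute.mul_pow hc.symm] at this
    simpa using this
  exact commutatorElement_eq_one_iff_mul_comm.1
    (h _ (hz' k) (isOfFinOrder_iff_pow_eq_one.2 ⟨n, hn, e2⟩))

theorem eq_one_of_isOfFinOrder_of_center [Group.IsNilpotent N]
    (h : ∀ z ∈ Subgroup.center N, IsOfFinOrder z → z = 1) (g : N) (hg : IsOfFinOrder g) :
    g = 1 := by
  revert h g
  refine Group.nilpotent_center_quotient_ind
    (P := fun G _ _ => (∀ z ∈ Subgroup.center G, IsOfFinOrder z → z = 1) →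
      ∀ g : G, IsOfFinOrder g → g = 1) N ?_ ?_
  · intro G _ _ _ g _
    exact Subsingleton.elim g 1
  · intro G _ _ ih h g hg
    refine h g ?_ hg
    rw [← QuotientGroup.eq_one_iff]
    exact ih (eq_one_of_mem_center_quotient_center h) _
      ((QuotientGroup.mk' (Subgroup.center G)).isOfFinOrder hg)

theorem mem_center_of_pow_mem_center [Group.IsNilpotent N]
    (h : ∀ g : N, IsOfFinOrder g → g = 1) {g : N} {n : ℕ} (hn : 0 < n)
    (hg : g ^ n ∈ Subgroup.center N) : g ∈ Subgroup.center N := by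
  rw [← QuotientGroup.eq_one_iff]
  refine eq_one_of_isOfFinOrder_of_center (eq_one_of_mem_center_quotient_center fun z _ => h z) _
    (isOfFinOrder_iff_pow_eq_one.2 ⟨n, hn, ?_⟩)
  rwa [← QuotientGroup.mk_pow, QuotientGroup.eq_one_iff]

theorem commute_of_commute_pow [Group.IsNilpotent N]
    (h : ∀ g : N, IsOfFinOrder g → g = 1) {x g : N} {n : ℕ} (hn : 0 < n)
    (hx : Commute x (g ^ n)) : Commute x g := by
  set M := Subgroup.closure {x, g}
  have hxM : x ∈ M := Subgroup.subset_closure (Or.inl rfl)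
  have hgM : g ∈ M := Subgroup.subset_closure (Or.inr rfl)
  have hM : ∀ a : M, IsOfFinOrder a → a = 1 := fun a ha =>
    Subtype.ext (h _ (M.subtype.isOfFinOrder ha))
  have hc : (⟨g, hgM⟩ : M) ^ n ∈ Subgroup.center M := by
    rw [Subgroup.mem_center_iff]
    rintro ⟨a, ha⟩
    have : M ≤ Subgroup.centralizer {g ^ n} := by
      rw [Subgroup.closure_le]
      rintro _ (rfl | rfl)
      · exact Subgroup.mem_centralizer_singleton_iff.2 hx
      · exact Subgroup.mem_centralizer_singleton_iff.2 ((Commute.refl _).pow_right n)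
    exact Subtype.ext (Subgroup.mem_centralizer_singleton_iff.1 (this ha))
  have := Subgroup.mem_center_iff.1 (mem_center_of_pow_mem_center hM hn hc) ⟨x, hxM⟩
  exact congrArg Subtype.val this

theorem eq_one_of_isOfFinOrder_quotient {K : Subgroup N} [K.Normal]
    (h : ∀ (g : N) (n : ℕ), 0 < n → g ^ n ∈ K → g ∈ K) (a : N ⧸ K) (ha : IsOfFinOrder a) :
    a = 1 := by
  induction a using QuotientGroup.induction_on with
  | H a =>
  obtain ⟨m, hm, ham⟩ := isOfFinOrder_iff_pow_eq_one.1 ha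
  rw [← QuotientGroup.mk_pow, QuotientGroup.eq_one_iff] at ham
  exact (QuotientGroup.eq_one_iff a).2 (h a m hm ham)

/-- The quotients of a torsion-free nilpotent group by the terms of its upper central series are
torsion-free. -/
theorem mem_upperCentralSeries_of_pow_mem [Group.IsNilpotent N]
    (h : ∀ g : N, IsOfFinOrder g → g = 1) (i : ℕ) :
    ∀ {g : N} {n : ℕ}, 0 < n → g ^ n ∈ Subgroup.upperCentralSeries N i →
      g ∈ Subgroup.upperCentralSeries N i := by
  induction i with
  | zero =>
    intro g n hn hg
    rw [Subgroup.upperCentralSeries_zero, Subgroup.mem_bot] at hg ⊢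
    exact h g (isOfFinOrder_iff_pow_eq_one.2 ⟨n, hn, hg⟩)
  | succ i ih =>
    intro g n hn hg
    rw [Subgroup.mem_upperCentralSeries_succ_iff] at hg ⊢
    intro y
    rw [← QuotientGroup.eq_one_iff, ← QuotientGroup.coe_mk', map_commutatorElement,
      commutatorElement_eq_one_iff_commute]
    refine (commute_of_commute_pow (eq_one_of_isOfFinOrder_quotient fun _ _ => ih) hn ?_).symm
    rw [← map_pow]
    apply Commute.symm
    rw [← commutatorElement_eq_one_iff_commute, ← map_commutatorElement, QuotientGroup.coe_mk',
      QuotientGroup.eq_one_iff]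
    exact hg y

/-- A subgroup containing a positive power of every element of a torsion-free nilpotent group
controls the nilpotency class: its lower central series, read backwards, lies in the upper central
series of the whole group. -/
theorem nilpotencyClass_le_of_forall_pow_mem [Group.IsNilpotent N]
    (h : ∀ g : N, IsOfFinOrder g → g = 1) (H : Subgroup N)
    (hH : ∀ g : N, ∃ n, 0 < n ∧ g ^ n ∈ H) {c : ℕ} (hc : H.lowerCentralSeries c = ⊥) :
    Group.nilpotencyClass N ≤ c := by
  have key : ∀ i ≤ c, H.lowerCentralSeries (c - i) ≤ Subgroup.upperCentralSeries N i := by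
    intro i
    induction i with
    | zero => intro _; simp [hc]
    | succ i ih =>
      intro hi x hx
      rw [Subgroup.mem_upperCentralSeries_succ_iff]
      intro y
      obtain ⟨n, hn, hyn⟩ := hH y
      have hxy : ⁅x, y ^ n⁆ ∈ Subgroup.upperCentralSeries N i := by
        apply ih (by omega)
        rw [show c - i = c - (i + 1) + 1 by omega, Subgroup.lowerCentralSeries_succ]
        exact Subgroup.commutator_mem_commutator hx hyn
      rw [← QuotientGroup.eq_one_iff, ← QuotientGroup.coe_mk', map_commutatorElement,
        commutatorElement_eq_one_iff_commute] at hxy ⊢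
      rw [map_pow] at hxy
      exact commute_of_commute_pow (eq_one_of_isOfFinOrder_quotient fun _ _ =>
        mem_upperCentralSeries_of_pow_mem h i) hn hxy
  rw [← Subgroup.upperCentralSeries_eq_top_iff_nilpotencyClass_le, eq_top_iff]
  intro g _
  obtain ⟨n, hn, hg⟩ := hH g
  refine mem_upperCentralSeries_of_pow_mem h c hn (key c le_rfl ?_)
  simpa using hg

end NilpotentGroups

/-! ### Nilpotent groups of linear operators -/

section Linear

variable {F : Type*} [Field F] {V : Type*} [AddCommGroup V] [Module F V]

/-- A central element of an irreducible linear group over an algebraically closed field is a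
scalar. -/
theorem exists_eq_algebraMap_of_irreducible [IsAlgClosed F] [FiniteDimensional F V] [Nontrivial V]
    {S : Set (Module.End F V)}
    (hirr : ∀ W : Submodule F V, (∀ g ∈ S, W ≤ W.comap g) → W = ⊥ ∨ W = ⊤)
    {z : Module.End F V} (hz : ∀ g ∈ S, Commute z g) :
    ∃ c : F, z = algebraMap F (Module.End F V) c := by
  obtain ⟨c, hc⟩ := Module.End.exists_eigenvalue z
  refine ⟨c, ?_⟩
  rcases hirr (z.eigenspace c) 
    (fun g hg => Module.End.mapsTo_genEigenspace_of_comm (hz g hg) c 1) with h | h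
  · exact absurd h hc
  · ext v
    have : v ∈ z.eigenspace c := h ▸ Submodule.mem_top
    simpa [Module.algebraMap_end_apply] using Module.End.mem_eigenspace_iff.1 this

/-- Every element of an irreducible nilpotent linear group over an algebraically closed field has
a positive power that is a scalar. Modulo the scalars, which are the centre, a central element `g`
has commutators `⁅g, h⁆` that are scalars of determinant one, so its order divides the
dimension. -/
theorem exists_pow_eq_algebraMap_of_irreducible [IsAlgClosed F] [FiniteDimensional F V]
    [Nontrivial V] (N : Subgroup (Module.End F V)ˣ) [Group.IsNilpotent N]
    (hirr : ∀ W : Submodule F V, (∀ g ∈ N, W ≤ W.comap (g : Module.End F V)) → W = ⊥ ∨ W = ⊤)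
    (g : (Module.End F V)ˣ) (hg : g ∈ N) :
    ∃ m, 0 < m ∧ ∃ c : F, ((g ^ m : (Module.End F V)ˣ) : Module.End F V) = algebraMap F _ c := by
  have schur : ∀ z : N, z ∈ Subgroup.center N →
      ∃ c : F, ((z : (Module.End F V)ˣ) : Module.End F V) = algebraMap F _ c := by
    intro z hz
    refine exists_eq_algebraMap_of_irreducible (S := {a | ∃ b ∈ N, (b : Module.End F V) = a}) ?_ ?_
    · intro W hW
      exact hirr W fun g hg => hW _ ⟨g, hg, rfl⟩
    · rintro _ ⟨b, hb, rfl⟩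
      have := Subgroup.mem_center_iff.1 hz ⟨b, hb⟩
      exact congrArg (fun a : N => ((a : (Module.End F V)ˣ) : Module.End F V)) this.symm
  have hn : 0 < Module.finrank F V := Module.finrank_pos
  have key : ∀ z ∈ Subgroup.center (N ⧸ Subgroup.center N), z ^ Module.finrank F V = 1 := by
    intro z
    induction z using QuotientGroup.induction_on with
    | H z =>
    intro hz
    have hz' : ∀ k : N, ⁅k, z⁆ ∈ Subgroup.center N := by
      intro k
      rw [← QuotientGroup.eq_one_iff, ← QuotientGroup.coe_mk', map_commutatorElement,
        commutatorElement_eq_one_iff_mul_comm]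
      exact Subgroup.mem_center_iff.1 hz _
    rw [← QuotientGroup.mk_pow, QuotientGroup.eq_one_iff, Subgroup.mem_center_iff]
    intro k
    have hc := Subgroup.mem_center_iff.1 (hz' k) z
    have e : k * z * k⁻¹ = ⁅k, z⁆ * z := by simp [commutatorElement_def]
    have e1 : ⁅k, z⁆ ^ Module.finrank F V = 1 := by
      obtain ⟨c, hc⟩ := schur _ (hz' k)
      have hdet : LinearMap.det (((⁅k, z⁆ : N) : (Module.End F V)ˣ) : Module.End F V) = 1 := by
        have : Units.map (LinearMap.det : Module.End F V →* F) ((⁅k, z⁆ : N) : (Module.End F V)ˣ)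
            = 1 := by
          change ((Units.map (LinearMap.det : Module.End F V →* F)).comp N.subtype) ⁅k, z⁆ = 1
          rw [map_commutatorElement, commutatorElement_eq_one_iff_mul_comm, mul_comm]
        exact congrArg Units.val this
      rw [hc, Algebra.algebraMap_eq_smul_one, LinearMap.det_smul, map_one, mul_one] at hdet
      apply Subtype.ext
      apply Units.ext
      simp [hc, ← map_pow, hdet]
    have e2 : k * z ^ Module.finrank F V * k⁻¹ = z ^ Module.finrank F V := by
      rw [← conj_pow, e, Commute.mul_pow hc.symm, e1, one_mul]
    exact mul_inv_eq_iff_eq_mul.1 e2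
  obtain ⟨m, hm, hgm⟩ := isOfFinOrder_iff_pow_eq_one.1
    (isOfFinOrder_of_forall_center_pow_eq_one hn key ((⟨g, hg⟩ : N) : N ⧸ Subgroup.center N))
  rw [← QuotientGroup.mk_pow, QuotientGroup.eq_one_iff] at hgm
  exact ⟨m, hm, schur _ hgm⟩

variable {N : Type*} [Group N]

theorem Representation.exists_pow_eq_algebraMap [Group.IsNilpotent N] [IsAlgClosed F]
    [FiniteDimensional F V] [Nontrivial V] (ρ : Representation F N V)
    (hirr : ∀ W : Submodule F V, (∀ g, W ≤ W.comap (ρ g)) → W = ⊥ ∨ W = ⊤) (g : N) :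
    ∃ m, 0 < m ∧ ∃ c : F, ρ (g ^ m) = algebraMap F _ c := by
  have : Group.IsNilpotent (MonoidHom.toHomUnits ρ).range :=
    Group.nilpotent_of_surjective _ (MonoidHom.toHomUnits ρ).rangeRestrict_surjective
  obtain ⟨m, hm, c, hc⟩ := exists_pow_eq_algebraMap_of_irreducible (MonoidHom.toHomUnits ρ).range
    (fun W hW => hirr W fun g => hW _ ⟨g, rfl⟩) (MonoidHom.toHomUnits ρ g) ⟨g, rfl⟩
  exact ⟨m, hm, c, by rw [← hc, ← map_pow]; rfl⟩

/-- `a` acts as a scalar on the subquotient `W' / W`. -/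
def ScalarOn (a : Module.End F V) (W W' : Submodule F V) : Prop :=
  ∃ c : F, ∀ v ∈ W', a v - c • v ∈ W

theorem ScalarOn.pow {a : Module.End F V} {W W' : Submodule F V} (h : ScalarOn a W W')
    (hW : W ≤ W.comap a) (k : ℕ) : ScalarOn (a ^ k) W W' := by
  obtain ⟨c, hc⟩ := h
  refine ⟨c ^ k, ?_⟩
  induction k with
  | zero => intro v _; simp
  | succ k ih =>
    intro v hv
    have h2 := W.add_mem (hW (ih v hv)) (W.smul_mem (c ^ k) (hc v hv))
    convert h2 using 1
    rw [pow_succ' a, Module.End.mul_apply, map_sub, map_smul, pow_succ, mul_smul, smul_sub]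
    abel

theorem Representation.exists_irreducible_submodule [FiniteDimensional F V] [Nontrivial V]
    (ρ : Representation F N V) : ∃ W : Submodule F V, W ≠ ⊥ ∧ (∀ g, W ≤ W.comap (ρ g)) ∧
      ∀ U ≤ W, (∀ g, U ≤ U.comap (ρ g)) → U = ⊥ ∨ U = W := by
  obtain ⟨W, ⟨hW, hinv⟩, hmin⟩ := WellFounded.has_min (wellFounded_lt (α := Submodule F V))
    {W | W ≠ ⊥ ∧ ∀ g, W ≤ W.comap (ρ g)} ⟨⊤, top_ne_bot, fun g => by simp⟩
  refine ⟨W, hW, hinv, fun U hU hUinv => ?_⟩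
  by_contra! h
  exact hmin U ⟨h.1, hUinv⟩ (lt_of_le_of_ne hU h.2)

universe v

/-- A composition series refines to a chain of length `finrank F V`, possibly with repetitions,
on whose factors every element of a nilpotent group has a positive power acting by a scalar. -/
theorem Representation.exists_flag [Group.IsNilpotent N] [IsAlgClosed F] (n : ℕ) :
    ∀ (V : Type v) [AddCommGroup V] [Module F V] [FiniteDimensional F V]
      (ρ : Representation F N V), Module.finrank F V = n →
      ∃ W : ℕ → Submodule F V, W 0 = ⊥ ∧ W n = ⊤ ∧ Monotone W ∧ (∀ g i, W i ≤ (W i).comap (ρ g)) ∧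
        ∀ g, ∃ m, 0 < m ∧ ∀ i, ScalarOn (ρ (g ^ m)) (W i) (W (i + 1)) := by
  induction n using Nat.strong_induction_on with
  | _ n ih =>
  intro V _ _ _ ρ hV
  rcases subsingleton_or_nontrivial V with hs | hs
  · refine ⟨fun _ => ⊥, rfl, Subsingleton.elim _ _, monotone_const, fun g i => bot_le, fun g =>
      ⟨1, one_pos, fun i => ⟨0, fun v _ => ?_⟩⟩⟩
    rw [Subsingleton.elim v 0]
    simp
  obtain ⟨W₁, hne, hinv, hmin⟩ := ρ.exists_irreducible_submodule
  have hrank := W₁.finrank_quotient_add_finrank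
  have : Nontrivial W₁ := Submodule.nontrivial_iff_ne_bot.2 hne
  have hpos : 0 < Module.finrank F W₁ := Module.finrank_pos
  obtain ⟨W', h0, h1, hmono, hinv', hsc⟩ := ih (Module.finrank F (V ⧸ W₁)) (by omega) (V ⧸ W₁)
    (ρ.quotient W₁ hinv) rfl
  let W : ℕ → Submodule F V := fun i => Nat.casesOn i ⊥ fun j => (W' j).comap W₁.mkQ
  have hWmono : Monotone W := by
    refine monotone_nat_of_le_succ fun i => ?_
    cases i with
    | zero => exact bot_le
    | succ i => exact Submodule.comap_mono (hmono i.le_succ)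
  refine ⟨W, rfl, ?_, hWmono, ?_, ?_⟩
  · rw [eq_top_iff]
    refine le_trans ?_ (hWmono (show Module.finrank F (V ⧸ W₁) + 1 ≤ n by omega))
    change ⊤ ≤ (W' _).comap W₁.mkQ
    rw [h1, Submodule.comap_top]
  · intro g i
    cases i with
    | zero => exact bot_le
    | succ i => exact fun v hv => hinv' g i hv
  · intro g
    obtain ⟨m₁, hm₁, c₁, hc₁⟩ := (ρ.subrepresentation W₁ hinv).exists_pow_eq_algebraMap (by
      intro U hU
      rcases hmin (U.map W₁.subtype) (Submodule.map_subtype_le _ _) (by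
        rintro g _ ⟨u, hu, rfl⟩
        exact ⟨_, hU g hu, rfl⟩) with h | h
      · refine Or.inl (Submodule.map_injective_of_injective W₁.injective_subtype ?_)
        rw [h, Submodule.map_bot]
      · refine Or.inr (Submodule.map_injective_of_injective W₁.injective_subtype ?_)
        rw [h, Submodule.map_subtype_top]) g
    obtain ⟨m₂, hm₂, hc₂⟩ := hsc g
    refine ⟨m₁ * m₂, Nat.mul_pos hm₁ hm₂, fun i => ?_⟩
    cases i with
    | zero =>
      rw [pow_mul, map_pow]
      refine ScalarOn.pow ⟨c₁, fun v hv => ?_⟩ bot_le m₂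
      change v ∈ (W' 0).comap W₁.mkQ at hv
      rw [h0, Submodule.comap_bot, Submodule.ker_mkQ] at hv
      have := congrArg Subtype.val (LinearMap.congr_fun hc₁ ⟨v, hv⟩)
      change _ - _ ∈ (⊥ : Submodule F V)
      rw [Submodule.mem_bot, sub_eq_zero]
      exact this
    | succ i =>
      obtain ⟨c, hc⟩ := (hc₂ i).pow (hinv' (g ^ m₂) i) m₁
      rw [mul_comm, pow_mul]
      refine ⟨c, fun v hv => ?_⟩
      have := hc (W₁.mkQ v) hv
      rw [← map_pow] at this
      exact this

/-! ### The lower central series along a flag -/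

section Flag

variable (ρ : Representation F N V) {W : ℕ → Submodule F V} (hmono : Monotone W)
  (hinv : ∀ g i, W i ≤ (W i).comap (ρ g))

/-- The subgroup of the elements acting as a scalar on every factor of the flag `W`. -/
def scalarSubgroup : Subgroup N where
  carrier := {g | ∀ i, ScalarOn (ρ g) (W i) (W (i + 1))}
  one_mem' i := ⟨1, fun v _ => by simp⟩
  mul_mem' {a b} ha hb i := by
    obtain ⟨c, hc⟩ := ha i
    obtain ⟨d, hd⟩ := hb i
    refine ⟨d * c, fun v hv => ?_⟩
    convert (W i).add_mem (hinv a i (hd v hv)) ((W i).smul_mem d (hc v hv)) using 1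
    simp [mul_smul, smul_sub]
  inv_mem' {a} ha i := by
    obtain ⟨c, hc⟩ := ha i
    refine ⟨c⁻¹, fun v hv => ?_⟩
    have h := hinv a⁻¹ i (hc v hv)
    rw [Submodule.mem_comap, map_sub, map_smul, ρ.inv_self_apply] at h
    rcases eq_or_ne c 0 with rfl | h0
    · -- here the factor is zero, so any scalar will do
      rw [zero_smul, sub_zero] at h
      rw [inv_zero, zero_smul, sub_zero]
      exact hinv a⁻¹ i h
    · convert (W i).smul_mem (-c⁻¹) h using 1
      rw [smul_sub, smul_smul, neg_mul, inv_mul_cancel₀ h0]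
      module

/-- The subgroup of the elements acting trivially on `W j / W (j - k)` for all `j`; the index
`j - k` is truncated at `0`. -/
def unipotentSubgroup (k : ℕ) : Subgroup N where
  carrier := {g | ∀ j, ∀ v ∈ W j, ρ g v - v ∈ W (j - k)}
  one_mem' j v _ := by simp
  mul_mem' {a b} ha hb j v hv := by
    convert (W (j - k)).add_mem (hinv a _ (hb j v hv)) (ha j v hv) using 1
    simp
  inv_mem' {a} ha j v hv := by
    have h := hinv a⁻¹ _ (ha j v hv)
    rw [Submodule.mem_comap, map_sub, ρ.inv_self_apply] at h
    convert (W (j - k)).neg_mem h using 1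
    abel

variable {ρ}

theorem commutator_mem_unipotentSubgroup_one {a b : N} (ha : a ∈ scalarSubgroup ρ hinv)
    (hb : b ∈ scalarSubgroup ρ hinv) (h0 : W 0 = ⊥) : ⁅a, b⁆ ∈ unipotentSubgroup ρ hinv 1 := by
  intro j v hv
  cases j with
  | zero =>
    rw [h0, Submodule.mem_bot] at hv
    simp [hv]
  | succ j =>
    obtain ⟨c, hc⟩ := ha j
    obtain ⟨d, hd⟩ := hb j
    set w := ρ (a⁻¹ * b⁻¹) v
    have hw : w ∈ W (j + 1) := hinv _ _ hv
    have e1 : ρ ⁅a, b⁆ v = ρ a (ρ b w) := by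
      rw [← Module.End.mul_apply, ← Module.End.mul_apply, ← map_mul, ← map_mul]
      congr 2
      simp [commutatorElement_def, mul_assoc]
    have e2 : v = ρ b (ρ a w) := by
      rw [← Module.End.mul_apply, ← Module.End.mul_apply, ← map_mul, ← map_mul]
      simp
    have h1 := (W j).add_mem (hinv a _ (hd w hw)) ((W j).smul_mem d (hc w hw))
    have h2 := (W j).add_mem (hinv b _ (hc w hw)) ((W j).smul_mem c (hd w hw))
    rw [map_sub, map_smul] at h1 h2
    have e3 : ρ ⁅a, b⁆ v - v = ρ a (ρ b w) - ρ b (ρ a w) := by rw [e1, ← e2]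
    rw [e3]
    change _ ∈ W j
    convert (W j).sub_mem h1 h2 using 1
    module

theorem conj_mem_unipotentSubgroup {k : ℕ} {u : N} (hu : u ∈ unipotentSubgroup ρ hinv k) (a : N) :
    a * u * a⁻¹ ∈ unipotentSubgroup ρ hinv k := by
  intro j v hv
  have := hinv a _ (hu j _ (hinv a⁻¹ _ hv))
  rw [Submodule.mem_comap, map_sub, ρ.self_inv_apply] at this
  rwa [map_mul, map_mul]

theorem commutator_mem_unipotentSubgroup {k : ℕ} {u : N} (hu : u ∈ unipotentSubgroup ρ hinv k)
    (h : N) : ⁅u, h⁆ ∈ unipotentSubgroup ρ hinv k := by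
  have := mul_mem hu (conj_mem_unipotentSubgroup hinv (inv_mem hu) h)
  rwa [show u * (h * u⁻¹ * h⁻¹) = ⁅u, h⁆ by simp [commutatorElement_def, mul_assoc]] at this

include hmono in
/-- Let `h` act by the scalars `a` and `b` on `W (i + k + 1) / W (i + k)` and `W (i + 1) / W i`.
The operator induced by `u - 1` between these factors is multiplied by `1 - b / a` when `u` is
replaced by `⁅u, h⁆`. -/
theorem smul_commutator_sub_mem {k i : ℕ} (hk : 1 ≤ k) {u h : N}
    (hu : u ∈ unipotentSubgroup ρ hinv k) {a b : F}
    (ha : ∀ v ∈ W (i + k + 1), ρ h v - a • v ∈ W (i + k))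
    (hb : ∀ v ∈ W (i + 1), ρ h v - b • v ∈ W i) {w : V} (hw : w ∈ W (i + k + 1)) :
    a • (ρ ⁅u, h⁆ w - w) - (a - b) • (ρ u w - w) ∈ W i := by
  have he := commutator_mem_unipotentSubgroup hinv hu h
  have hu1 : ρ u w - w ∈ W (i + 1) := by
    have := hu _ w hw
    rwa [show i + k + 1 - k = i + 1 by omega] at this
  -- `ρ (h * u) w` agrees with `a • w` up to the preceding term of the flag
  have h1 : ρ (h * u) w - a • w ∈ W (i + k) := by
    convert (W (i + k)).add_mem (hinv h _ (hmono (show i + 1 ≤ i + k by omega) hu1)) (ha w hw)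
      using 1
    simp
  have h2 := he _ _ h1
  have h3 := hu _ _ (ha w hw)
  have h4 := hb _ hu1
  rw [show i + k - k = i by omega] at h2 h3
  have e : ρ ⁅u, h⁆ (ρ (h * u) w) = ρ u (ρ h w) := by
    rw [← Module.End.mul_apply, ← Module.End.mul_apply, ← map_mul, ← map_mul]
    congr 2
    simp [commutatorElement_def]
  rw [map_sub, map_smul, e, map_mul, Module.End.mul_apply] at h2
  rw [map_sub, map_smul] at h3
  rw [map_sub] at h4
  convert (W i).sub_mem ((W i).sub_mem h3 h4) h2 using 1
  module

include hmono in
/-- In a nilpotent group, the commutator of `u` in the `k`-th step of the flag filtration with an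
element `h` acting by scalars on the factors lies in the `(k + 1)`-st step: on the operators
between two factors `u ↦ ⁅u, h⁆` is a multiplication by a scalar, which is nilpotent and therefore
zero. -/
theorem commutator_mem_unipotentSubgroup_succ [Group.IsNilpotent N] {k : ℕ} (hk : 1 ≤ k) {u h : N}
    (hu : u ∈ unipotentSubgroup ρ hinv k) (hh : h ∈ scalarSubgroup ρ hinv) :
    ⁅u, h⁆ ∈ unipotentSubgroup ρ hinv (k + 1) := by
  intro j w hw
  rcases Nat.lt_or_ge k j with hkj | hkj
  swap
  · have := commutator_mem_unipotentSubgroup hinv hu h j w hw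
    rwa [show j - k = j - (k + 1) by omega] at this
  obtain ⟨i, rfl⟩ : ∃ i, j = i + k + 1 := ⟨j - (k + 1), by omega⟩
  rw [show i + k + 1 - (k + 1) = i by omega]
  obtain ⟨a, ha⟩ := hh (i + k)
  obtain ⟨b, hb⟩ := hh i
  have step := fun u hu => smul_commutator_sub_mem (u := u) hmono hinv hk hu ha hb hw
  -- the iterated commutators of `u` with `h`, eventually trivial
  let e : ℕ → N := fun n => Nat.rec u (fun _ x => ⁅x, h⁆) n
  have he : ∀ n, e n ∈ unipotentSubgroup ρ hinv k := fun n => by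
    induction n with
    | zero => exact hu
    | succ n ih => exact commutator_mem_unipotentSubgroup hinv ih h
  have he2 : ∀ n, e n ∈ (⊤ : Subgroup N).lowerCentralSeries n := fun n => by
    induction n with
    | zero => trivial
    | succ n ih => exact Subgroup.commutator_mem_commutator ih (Subgroup.mem_top h)
  have he3 : ∀ n, a ^ n • (ρ (e n) w - w) - (a - b) ^ n • (ρ u w - w) ∈ W i := fun n => by
    induction n with
    | zero => simp [e]
    | succ n ih =>
      have h1 := (W i).smul_mem (a ^ n) (step _ (he n))
      have h2 := (W i).smul_mem (a - b) ih
      convert (W i).add_mem h1 h2 using 1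
      change a ^ (n + 1) • (ρ ⁅e n, h⁆ w - w) - _ = _
      module
  obtain ⟨c, hc⟩ := Subgroup.nilpotent_iff_lowerCentralSeries.1 ‹Group.IsNilpotent N›
  have hz : (a - b) ^ c • (ρ u w - w) ∈ W i := by
    have h1 := he2 c
    rw [hc, Subgroup.mem_bot] at h1
    simpa [h1] using he3 c
  have hz' : (a - b) • (ρ u w - w) ∈ W i := by
    rcases eq_or_ne (a - b) 0 with h0 | h0
    · simp [h0]
    · exact (W i).smul_mem _ (((W i).smul_mem_iff (pow_ne_zero c h0)).1 hz)
  have hfin : a • (ρ ⁅u, h⁆ w - w) ∈ W i := by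
    simpa using (W i).add_mem (step u hu) hz'
  rcases eq_or_ne a 0 with rfl | h0
  · -- the source factor is zero, so `w` already lies in the preceding term of the flag
    have hw' : w ∈ W (i + k) := by
      simpa using ha _ (hinv h⁻¹ _ hw)
    simpa using commutator_mem_unipotentSubgroup hinv hu h _ w hw'
  · exact ((W i).smul_mem_iff h0).1 hfin

include hmono in
theorem lowerCentralSeries_scalarSubgroup_le [Group.IsNilpotent N] (h0 : W 0 = ⊥) (k : ℕ) :
    (scalarSubgroup ρ hinv).lowerCentralSeries k ≤ unipotentSubgroup ρ hinv k := by
  induction k with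
  | zero => exact fun u _ j v hv => (W j).sub_mem (hinv u j hv) hv
  | succ k ih =>
    rw [Subgroup.lowerCentralSeries_succ, Subgroup.commutator_le]
    intro u hu h hh
    rcases Nat.eq_zero_or_pos k with rfl | hk
    · exact commutator_mem_unipotentSubgroup_one hinv hu hh h0
    · exact commutator_mem_unipotentSubgroup_succ hmono hinv hk (ih hu) hh

end Flag

/-! ### The class of a torsion-free nilpotent linear group -/

theorem nilpotencyClass_le_finrank_of_isAlgClosed [IsAlgClosed F] [FiniteDimensional F V]
    [Group.IsNilpotent N] (hN : ∀ g : N, IsOfFinOrder g → g = 1) (ρ : Representation F N V)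
    (hρ : Function.Injective ρ) : Group.nilpotencyClass N ≤ Module.finrank F V := by
  obtain ⟨W, h0, h1, hmono, hinv, hsc⟩ := ρ.exists_flag _ V rfl
  refine nilpotencyClass_le_of_forall_pow_mem hN (scalarSubgroup ρ hinv) hsc ?_
  rw [eq_bot_iff]
  intro u hu
  refine hρ (LinearMap.ext fun v => ?_)
  have := lowerCentralSeries_scalarSubgroup_le hmono hinv h0 _ hu _ v (h1 ▸ Submodule.mem_top)
  rw [Nat.sub_self, h0, Submodule.mem_bot, sub_eq_zero] at this
  simpa using this

/-- A torsion-free nilpotent linear group of degree `d`, over any field, has class at most `d`. -/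
theorem nilpotencyClass_le_of_injective_matrix [Group.IsNilpotent N]
    (hN : ∀ g : N, IsOfFinOrder g → g = 1) {d : ℕ} (ρ : N →* Matrix (Fin d) (Fin d) F)
    (hρ : Function.Injective ρ) : Group.nilpotencyClass N ≤ d := by
  let K := AlgebraicClosure F
  let e : Matrix (Fin d) (Fin d) K ≃ₐ[K] Module.End K (Fin d → K) := Matrix.toLinAlgEquiv'
  let φ : Representation K N (Fin d → K) :=
    (e : Matrix (Fin d) (Fin d) K →* Module.End K (Fin d → K)).comp
      ((algebraMap F K).mapMatrix.toMonoidHom.comp ρ)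
  have hφ : Function.Injective φ :=
    e.injective.comp ((Matrix.map_injective (algebraMap F K).injective).comp hρ)
  simpa using nilpotencyClass_le_finrank_of_isAlgClosed hN φ hφ

theorem Representation.nilpotencyClass_le_finrank [FiniteDimensional F V] [Group.IsNilpotent N]
    (hN : ∀ g : N, IsOfFinOrder g → g = 1) (ρ : Representation F N V)
    (hρ : Function.Injective ρ) : Group.nilpotencyClass N ≤ Module.finrank F V := by
  let e := LinearMap.toMatrixAlgEquiv (Module.finBasis F V)
  exact nilpotencyClass_le_of_injective_matrix hN
    ((e : Module.End F V →* Matrix _ _ F).comp ρ) (e.injective.comp hρ)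

end Linear

namespace Cremona

open Polynomial

variable {K : Type*} [Field K]

/-! ### Comorphisms of the generators -/

theorem transcendental_x : Transcendental K (x K) :=
  isTranscendenceBasis_coord.1.transcendental 0

@[simp] theorem unop_mul_apply (φ ψ : Cr₂ K) (z : RatField K) :
    (φ * ψ).unop z = ψ.unop (φ.unop z) := rfl

theorem unop_inv_eq_of_unop_eq {φ : Cr₂ K} {z w : RatField K} (h : φ.unop z = w) :
    φ⁻¹.unop w = z := by
  subst h
  exact φ.unop.symm_apply_apply z

@[simp] theorem s_x (t : K) : (s t).unop (x K) = x K + algebraMap K (RatField K) t :=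
  birational_x _ _ _

@[simp] theorem s_y (t : K) : (s t).unop (y K) = y K := birational_y _ _ _

@[simp] theorem α_x (f : RatFunc K) : (α f).unop (x K) = x K := birational_x _ _ _

@[simp] theorem α_y (f : RatFunc K) : (α f).unop (y K) = y K + atX K f := birational_y _ _ _

@[simp] theorem μ_x (g : (RatFunc K)ˣ) : (μ g).unop (x K) = x K := birational_x _ _ _

@[simp] theorem μ_y (g : (RatFunc K)ˣ) : (μ g).unop (y K) = y K * atX K (g : RatFunc K) :=
  birational_y _ _ _

@[simp] theorem atX_X : atX K RatFunc.X = x K := by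
  rw [← RatFunc.algebraMap_X, atX_algebraMap, aeval_X]

/-- The comorphism of a commutator at `z`, from a solution `w` of `ψ(φ(w)) = φ(ψ(z))`, products
being composed as transformations. -/
theorem unop_commutator_eq {φ ψ : Cr₂ K} {z w : RatField K}
    (h : (ψ * φ).unop w = (φ * ψ).unop z) : ⁅φ, ψ⁆.unop z = w := by
  apply (ψ * φ).unop.injective
  rw [h, ← unop_mul_apply]
  congr 2
  simp [commutatorElement_def, mul_assoc]

/-! ### Transformations affine in `y` and the derived series of `G` -/

variable (K) in
/-- The subfield `K(x)` of `K(x, y)`. -/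
noncomputable def fieldX : IntermediateField K (RatField K) := IntermediateField.adjoin K {x K}

theorem x_mem_fieldX : x K ∈ fieldX K := IntermediateField.mem_adjoin_simple_self K _

theorem unop_mem_fieldX {φ : Cr₂ K} (hφ : φ.unop (x K) ∈ fieldX K) {e : RatField K}
    (he : e ∈ fieldX K) : φ.unop e ∈ fieldX K := by
  have : fieldX K ≤ (fieldX K).comap (φ.unop : RatField K →ₐ[K] RatField K) := by
    rw [fieldX, IntermediateField.adjoin_le_iff, Set.singleton_subset_iff]
    exact hφ
  exact this he

theorem unop_eq_self {φ : Cr₂ K} (hφ : φ.unop (x K) = x K) {e : RatField K}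
    (he : e ∈ fieldX K) : φ.unop e = e := by
  induction he using IntermediateField.adjoin_induction with
  | mem z hz => rw [Set.mem_singleton_iff.1 hz, hφ]
  | algebraMap z => simp
  | add z w _ _ hz hw => rw [map_add, hz, hw]
  | inv z _ hz => rw [map_inv₀, hz]
  | mul z w _ _ hz hw => rw [map_mul, hz, hw]

/-- The transformations `(x, y) ↦ (x + t, a(x) y + b(x))` with `t` in a given group of
translations. -/
def affineSubgroup (T : AddSubgroup K) : Subgroup (Cr₂ K) where
  carrier := {φ | (∃ t ∈ T, φ.unop (x K) = x K + algebraMap K (RatField K) t) ∧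
    ∃ a ∈ fieldX K, a ≠ 0 ∧ ∃ b ∈ fieldX K, φ.unop (y K) = a * y K + b}
  one_mem' := ⟨⟨0, T.zero_mem, by simp⟩, 1, one_mem _, one_ne_zero, 0, zero_mem _, by simp⟩
  mul_mem' {φ ψ} := by
    rintro ⟨⟨t, ht, hφx⟩, a, ha, ha0, b, hb, hφy⟩ ⟨⟨u, hu, hψx⟩, c, hc, hc0, d, hd, hψy⟩
    have hψ : ψ.unop (x K) ∈ fieldX K :=
      hψx ▸ add_mem x_mem_fieldX (IntermediateField.algebraMap_mem _ u)
    have ha' := unop_mem_fieldX hψ ha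
    refine ⟨⟨t + u, T.add_mem ht hu, ?_⟩, ψ.unop a * c, mul_mem ha' hc,
      mul_ne_zero ((map_ne_zero ψ.unop).2 ha0) hc0, ψ.unop a * d + ψ.unop b,
      add_mem (mul_mem ha' hd) (unop_mem_fieldX hψ hb), ?_⟩
    · rw [unop_mul_apply, hφx, map_add, hψx, AlgEquiv.commutes, map_add]
      ring
    · rw [unop_mul_apply, hφy, map_add, map_mul, hψy]
      ring
  inv_mem' {φ} := by
    rintro ⟨⟨t, ht, hφx⟩, a, ha, ha0, b, hb, hφy⟩
    have hx : φ⁻¹.unop (x K) = x K + algebraMap K (RatField K) (-t) := by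
      apply unop_inv_eq_of_unop_eq
      rw [map_add, hφx, AlgEquiv.commutes, map_neg]
      ring
    have hφ : φ⁻¹.unop (x K) ∈ fieldX K :=
      hx ▸ add_mem x_mem_fieldX (IntermediateField.algebraMap_mem _ _)
    have ha' := unop_mem_fieldX hφ ha
    have ha0' : φ⁻¹.unop a ≠ 0 := (map_ne_zero φ⁻¹.unop).2 ha0
    have h := unop_inv_eq_of_unop_eq hφy
    rw [map_add, map_mul] at h
    refine ⟨⟨-t, T.neg_mem ht, hx⟩, (φ⁻¹.unop a)⁻¹, inv_mem ha', inv_ne_zero ha0',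
      -((φ⁻¹.unop a)⁻¹ * φ⁻¹.unop b),
      neg_mem (mul_mem (inv_mem ha') (unop_mem_fieldX hφ hb)), ?_⟩
    field_simp
    linear_combination h

variable (K) in
/-- The transformations `(x, y) ↦ (x, y + b(x))`. -/
def shearSubgroup : Subgroup (Cr₂ K) where
  carrier := {φ | φ.unop (x K) = x K ∧ ∃ b ∈ fieldX K, φ.unop (y K) = y K + b}
  one_mem' := ⟨rfl, 0, zero_mem _, by simp⟩
  mul_mem' {φ ψ} := by
    rintro ⟨hφx, b, hb, hφy⟩ ⟨hψx, d, hd, hψy⟩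
    refine ⟨by rw [unop_mul_apply, hφx, hψx], d + b, add_mem hd hb, ?_⟩
    rw [unop_mul_apply, hφy, map_add, hψy, unop_eq_self hψx hb, add_assoc]
  inv_mem' {φ} := by
    rintro ⟨hφx, b, hb, hφy⟩
    refine ⟨unop_inv_eq_of_unop_eq hφx, -b, neg_mem hb, unop_inv_eq_of_unop_eq ?_⟩
    rw [map_add, map_neg, hφy, unop_eq_self hφx hb, add_neg_cancel_right]

theorem commutator_affineSubgroup_le (T : AddSubgroup K) :
    ⁅affineSubgroup T, affineSubgroup T⁆ ≤ affineSubgroup (⊥ : AddSubgroup K) := by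
  rw [Subgroup.commutator_le]
  intro φ hφ ψ hψ
  refine ⟨⟨0, zero_mem _, unop_commutator_eq ?_⟩, ?_⟩
  · obtain ⟨⟨t, -, hφx⟩, -⟩ := hφ
    obtain ⟨⟨u, -, hψx⟩, -⟩ := hψ
    simp only [unop_mul_apply, map_zero, add_zero, hφx, hψx, map_add, AlgEquiv.commutes]
    ring
  · exact (mul_mem (mul_mem (mul_mem hφ hψ) (inv_mem hφ)) (inv_mem hψ)).2

theorem commutator_affineSubgroup_bot_le :
    ⁅affineSubgroup (⊥ : AddSubgroup K), affineSubgroup (⊥ : AddSubgroup K)⁆ ≤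
      shearSubgroup K := by
  rw [Subgroup.commutator_le]
  rintro φ ⟨⟨t, ht, hφx⟩, a, ha, ha0, b, hb, hφy⟩ ψ ⟨⟨u, hu, hψx⟩, c, hc, hc0, d, hd, hψy⟩
  rw [AddSubgroup.mem_bot.1 ht, map_zero, add_zero] at hφx
  rw [AddSubgroup.mem_bot.1 hu, map_zero, add_zero] at hψx
  refine ⟨unop_commutator_eq (by rw [unop_mul_apply, unop_mul_apply, hφx, hψx, hφx]),
    a * d + b - (c * b + d),
    sub_mem (add_mem (mul_mem ha hd) hb) (add_mem (mul_mem hc hb) hd), unop_commutator_eq ?_⟩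
  simp only [unop_mul_apply, map_add, map_sub, map_mul, hφy, hψy, unop_eq_self hφx ha,
    unop_eq_self hφx hb, unop_eq_self hφx hc, unop_eq_self hφx hd, unop_eq_self hψx ha,
    unop_eq_self hψx hb, unop_eq_self hψx hc, unop_eq_self hψx hd]
  ring

theorem commutator_shearSubgroup : ⁅shearSubgroup K, shearSubgroup K⁆ = ⊥ := by
  rw [eq_bot_iff, Subgroup.commutator_le]
  rintro φ ⟨hφx, b, hb, hφy⟩ ψ ⟨hψx, d, hd, hψy⟩
  rw [Subgroup.mem_bot, commutatorElement_eq_one_iff_mul_comm]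
  refine Cr₂.ext (by rw [unop_mul_apply, unop_mul_apply, hφx, hψx, hφx]) ?_
  simp only [unop_mul_apply, map_add, hφy, hψy, unop_eq_self hφx hd, unop_eq_self hψx hb]
  ring

theorem G_le_affineSubgroup : G ≤ affineSubgroup (⊤ : AddSubgroup ℚ) := by
  rw [G, Subgroup.closure_le]
  rintro _ (rfl | rfl | rfl)
  · exact ⟨⟨1, trivial, s_x 1⟩, 1, one_mem _, one_ne_zero, 0, zero_mem _, by simp⟩
  · exact ⟨⟨0, trivial, by simp⟩, 1, one_mem _, one_ne_zero, 1, one_mem _, by simp⟩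
  · exact ⟨⟨0, trivial, by simp⟩, x ℚ, x_mem_fieldX, x_ne_zero, 0, zero_mem _, by simp [mul_comm]⟩

theorem derivedSeries_G_three : derivedSeries G 3 = ⊥ := by
  have h0 : (derivedSeries G 0).map G.subtype ≤ affineSubgroup ⊤ :=
    (Subgroup.map_subtype_le _).trans G_le_affineSubgroup
  have h1 : (derivedSeries G 1).map G.subtype ≤ affineSubgroup ⊥ := by
    rw [derivedSeries_succ, Subgroup.map_commutator]
    exact (Subgroup.commutator_mono h0 h0).trans (commutator_affineSubgroup_le _)
  have h2 : (derivedSeries G 2).map G.subtype ≤ shearSubgroup ℚ := by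
    rw [derivedSeries_succ, Subgroup.map_commutator]
    exact (Subgroup.commutator_mono h1 h1).trans commutator_affineSubgroup_bot_le
  have h3 : (derivedSeries G 3).map G.subtype ≤ ⊥ := by
    rw [derivedSeries_succ, Subgroup.map_commutator]
    exact (Subgroup.commutator_mono h2 h2).trans commutator_shearSubgroup.le
  exact (Subgroup.map_eq_bot_iff_of_injective _ G.subtype_injective).1 (le_bot_iff.1 h3)

theorem x_ne_algebraMap (t : K) : x K ≠ algebraMap K (RatField K) t := fun h =>
  transcendental_x (h ▸ isAlgebraic_algebraMap t)

theorem commutator_s_unop_y {m : Cr₂ K} (hmx : m.unop (x K) = x K)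
    (hmy : m.unop (y K) = y K * x K) :
    ⁅s (1 : K), m⁆.unop (y K) = (x K - 1) / x K * y K := by
  have key : ∀ {L : Type _} [Field L] (a b : L), a + 1 ≠ 0 →
      (a + 1 - 1) / (a + 1) * (b * (a + 1)) = b * a := by
    intro L _ a b h
    field_simp
    ring
  refine unop_commutator_eq ?_
  simp only [unop_mul_apply, map_mul, map_div₀, map_sub, map_one, hmx, hmy, s_x, s_y]
  refine key _ _ fun h => x_ne_algebraMap (-1 : K) ?_
  rw [map_neg, map_one]
  exact eq_neg_of_add_eq_zero_left h

theorem commutator_α_unop_y {m : Cr₂ K} (hmx : m.unop (x K) = x K)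
    (hmy : m.unop (y K) = y K * x K) :
    ⁅α (1 : RatFunc K), m⁆.unop (y K) = y K + (1 - x K) := by
  have key : ∀ {L : Type _} [Field L] (a b : L), (b + 1) * a + (1 - a) = b * a + 1 := by
    intro L _ a b
    ring
  refine unop_commutator_eq ?_
  simp only [unop_mul_apply, map_add, map_mul, map_sub, map_one, hmx, hmy, α_x, α_y]
  exact key _ _

theorem muX_y : (μ (K := K) (Units.mk0 RatFunc.X RatFunc.X_ne_zero)).unop (y K) = y K * x K := by
  rw [μ_y, Units.val_mk0, atX_X]

/-- The transformations `⁅s₁, μ_X⁆ : y ↦ y (x - 1) / x` and `⁅α₁, μ_X⁆ : y ↦ y + 1 - x` do not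
commute. -/
theorem commutator_commutator_ne_one {m : Cr₂ K} (hmx : m.unop (x K) = x K)
    (hmy : m.unop (y K) = y K * x K) :
    ⁅⁅s (1 : K), m⁆, ⁅α (1 : RatFunc K), m⁆⁆ ≠ 1 := by
  intro key
  have field_key : ∀ {L : Type _} [Field L] (a b : L), a ≠ 0 →
      (a - 1) / a * (b + (1 - a)) = (a - 1) / a * b + (1 - a) → a = 1 := by
    intro L _ a b h0 h
    field_simp at h
    linear_combination h
  have e1y := commutator_s_unop_y hmx hmy
  have e2x : ⁅α (1 : RatFunc K), m⁆.unop (x K) = x K := unop_commutator_eq (by simp [hmx])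
  have e1x : ⁅s (1 : K), m⁆.unop (x K) = x K := unop_commutator_eq (by simp [hmx])
  have e2y := commutator_α_unop_y hmx hmy
  rw [commutatorElement_eq_one_iff_mul_comm] at key
  have h2 := congrArg (fun φ : Cr₂ K => φ.unop (y K)) key
  simp only [unop_mul_apply, map_add, map_mul, map_sub, map_div₀, map_one, e1x, e1y, e2x, e2y]
    at h2
  have hx : x K = 1 := field_key (x K) (y K) x_ne_zero h2
  exact x_ne_algebraMap (1 : K) (by rw [hx, map_one])

theorem derivedSeries_G_two_ne_bot : derivedSeries G 2 ≠ ⊥ := by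
  intro h
  have hc : ∀ a b c d : G, ⁅⁅a, b⁆, ⁅c, d⁆⁆ = 1 := by
    intro a b c d
    rw [← Subgroup.mem_bot, ← h, derivedSeries_succ, derivedSeries_succ, derivedSeries_zero]
    exact Subgroup.commutator_mem_commutator
      (Subgroup.commutator_mem_commutator (Subgroup.mem_top _) (Subgroup.mem_top _))
      (Subgroup.commutator_mem_commutator (Subgroup.mem_top _) (Subgroup.mem_top _))
  have hs : s 1 ∈ G := Subgroup.subset_closure (Or.inl rfl)
  have hα : α 1 ∈ G := Subgroup.subset_closure (Or.inr (Or.inl rfl))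
  have hm : μ (Units.mk0 RatFunc.X RatFunc.X_ne_zero) ∈ G :=
    Subgroup.subset_closure (Or.inr (Or.inr rfl))
  exact commutator_commutator_ne_one (μ_x _) muX_y
    (congrArg Subtype.val (hc ⟨_, hs⟩ ⟨_, hm⟩ ⟨_, hα⟩ ⟨_, hm⟩))

theorem isLeast_derivedSeries_G : IsLeast {k : ℕ | derivedSeries G k = ⊥} 3 := by
  refine ⟨derivedSeries_G_three, fun k hk => ?_⟩
  by_contra! hlt
  exact derivedSeries_G_two_ne_bot
    (le_bot_iff.1 ((derivedSeries_antitone G (Nat.le_of_lt_succ hlt)).trans (le_of_eq hk)))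

/-! ### Polynomial shears and the groups `Γ_n` -/

/-- `φ` is the transformation `(x, y) ↦ (x + t, y + p(x))`. -/
structure IsPolyShear (φ : Cr₂ K) (t : K) (p : K[X]) : Prop where
  x_eq : φ.unop (x K) = x K + algebraMap K (RatField K) t
  y_eq : φ.unop (y K) = y K + aeval (x K) p

namespace IsPolyShear

variable {φ ψ : Cr₂ K} {t u : K} {p q : K[X]}

theorem unop_aeval (h : IsPolyShear φ t p) (q : K[X]) :
    φ.unop (aeval (x K) q) = aeval (x K) (taylor t q) := by
  have : φ.unop (aeval (x K) q) = aeval (φ.unop (x K)) q :=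
    (aeval_algHom_apply (φ.unop : RatField K →ₐ[K] RatField K) (x K) q).symm
  rw [this, h.x_eq, taylor_apply, aeval_comp]
  simp

theorem one : IsPolyShear (1 : Cr₂ K) 0 0 := ⟨by simp, by simp⟩

theorem mul (hφ : IsPolyShear φ t p) (hψ : IsPolyShear ψ u q) :
    IsPolyShear (φ * ψ) (t + u) (taylor u p + q) := by
  constructor
  · rw [unop_mul_apply, hφ.x_eq, map_add, hψ.x_eq, AlgEquiv.commutes, map_add]
    ring
  · rw [unop_mul_apply, hφ.y_eq, map_add, hψ.y_eq, hψ.unop_aeval, map_add]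
    ring

theorem inv (hφ : IsPolyShear φ t p) : IsPolyShear φ⁻¹ (-t) (-taylor (-t) p) := by
  constructor <;> apply unop_inv_eq_of_unop_eq
  · rw [map_add, hφ.x_eq, AlgEquiv.commutes, map_neg]
    ring
  · rw [map_add, map_neg, hφ.y_eq, map_neg, hφ.unop_aeval, taylor_taylor]
    simp

theorem unique (h : IsPolyShear φ t p) (h' : IsPolyShear φ u q) : t = u ∧ p = q := by
  constructor
  · exact (algebraMap K (RatField K)).injective (add_left_cancel (h.x_eq.symm.trans h'.x_eq))
  · exact transcendental_iff_injective.1 transcendental_x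
      (add_left_cancel (h.y_eq.symm.trans h'.y_eq))

theorem eq_one (h : IsPolyShear φ 0 0) : φ = 1 :=
  Cr₂.ext (by simp [h.x_eq]) (by simp [h.y_eq])

theorem commutator (hφ : IsPolyShear φ t p) (hψ : IsPolyShear ψ u q) :
    IsPolyShear ⁅φ, ψ⁆ 0 (taylor (-(t + u)) ((taylor u p - p) - (taylor t q - q))) := by
  have h := (hφ.mul hψ).mul (hψ.mul hφ).inv
  rw [show φ * ψ * (ψ * φ)⁻¹ = ⁅φ, ψ⁆ by simp [commutatorElement_def, mul_assoc]] at h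
  convert h using 1
  · ring
  · rw [add_comm u t, ← sub_eq_add_neg, ← map_sub]
    congr 1
    ring

theorem pow (hφ : IsPolyShear φ 0 p) (n : ℕ) : IsPolyShear (φ ^ n) 0 (n • p) := by
  induction n with
  | zero => simpa using one
  | succ n ih =>
    rw [pow_succ]
    convert ih.mul hφ using 1
    · simp
    · rw [taylor_zero, succ_nsmul]

theorem x_eq_of_pow (hφ : IsPolyShear φ t p) (n : ℕ) :
    (φ ^ n).unop (x K) = x K + algebraMap K (RatField K) (n * t) := by
  induction n with
  | zero => simp
  | succ n ih =>
    rw [pow_succ, unop_mul_apply, ih, map_add, hφ.x_eq, AlgEquiv.commutes, add_assoc, ← map_add]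
    congr 2
    push_cast
    ring

theorem eq_one_of_isOfFinOrder [CharZero K] (hφ : IsPolyShear φ t p) (h : IsOfFinOrder φ) :
    φ = 1 := by
  obtain ⟨n, hn, hpow⟩ := isOfFinOrder_iff_pow_eq_one.1 h
  have hn' : (n : K) ≠ 0 := Nat.cast_ne_zero.2 hn.ne'
  have h1 := hφ.x_eq_of_pow n
  rw [hpow] at h1
  have h2 : algebraMap K (RatField K) (n * t) = 0 := left_eq_add.1 h1
  rw [map_eq_zero_iff _ (algebraMap K (RatField K)).injective] at h2
  obtain rfl : t = 0 := (mul_eq_zero.1 h2).resolve_left hn'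
  have h3 := (hφ.pow n).unique (hpow ▸ one)
  obtain rfl : p = 0 := (smul_eq_zero.1 h3.2).resolve_left hn.ne'
  exact hφ.eq_one

end IsPolyShear

theorem coeff_taylor_eq_of_degreeLT {p : K[X]} {k m : ℕ} (hp : p ∈ degreeLT K (k + 1)) (hm : k ≤ m)
    (t : K) : (taylor t p).coeff m = p.coeff m := by
  rw [mem_degreeLT, degree_lt_iff_coeff_zero] at hp
  have : hasseDeriv m p = C (p.coeff m) := by
    ext n
    rw [hasseDeriv_coeff, coeff_C]
    split_ifs with h
    · simp [h]
    · rw [hp _ (by omega), mul_zero]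
  rw [taylor_coeff, this, eval_C]

theorem taylor_sub_mem_degreeLT {p : K[X]} {k : ℕ} (hp : p ∈ degreeLT K (k + 1)) (t : K) :
    taylor t p - p ∈ degreeLT K k := by
  rw [mem_degreeLT, degree_lt_iff_coeff_zero]
  intro m hm
  rw [coeff_sub, coeff_taylor_eq_of_degreeLT hp hm, sub_self]

theorem taylor_mem_degreeLT {p : K[X]} {k : ℕ} (hp : p ∈ degreeLT K k) (t : K) :
    taylor t p ∈ degreeLT K k := by
  rw [mem_degreeLT] at hp ⊢
  rwa [degree_taylor]

theorem coeff_taylor_sub {p : K[X]} {k : ℕ} (hp : p ∈ degreeLT K (k + 2)) (t : K) :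
    (taylor t p - p).coeff k = (k + 1) * p.coeff (k + 1) * t := by
  rw [mem_degreeLT, degree_lt_iff_coeff_zero] at hp
  have : hasseDeriv k p = C (p.coeff k) + C ((k + 1) * p.coeff (k + 1)) * X := by
    ext n
    rw [hasseDeriv_coeff, coeff_add, coeff_C]
    match n with
    | 0 => simp
    | 1 => simp [coeff_C, add_comm 1 k]
    | n + 2 =>
      rw [hp _ (by omega), coeff_C_mul, coeff_X]
      simp
  rw [coeff_sub, taylor_coeff, this]
  simp

/-- The transformations `(x, y) ↦ (x + t, y + p(x))` with `deg p < n` and `t` in a given group of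
translations. -/
def polyShearSubgroup (T : AddSubgroup K) (n : ℕ) : Subgroup (Cr₂ K) where
  carrier := {φ | ∃ t ∈ T, ∃ p ∈ degreeLT K n, IsPolyShear φ t p}
  one_mem' := ⟨0, zero_mem _, 0, zero_mem _, .one⟩
  mul_mem' := by
    rintro φ ψ ⟨t, ht, p, hp, hφ⟩ ⟨u, hu, q, hq, hψ⟩
    exact ⟨_, add_mem ht hu, _, add_mem (taylor_mem_degreeLT hp u) hq, hφ.mul hψ⟩
  inv_mem' := by
    rintro φ ⟨t, ht, p, hp, hφ⟩
    exact ⟨_, neg_mem ht, _, neg_mem (taylor_mem_degreeLT hp _), hφ.inv⟩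

theorem isPolyShear_s (t : K) : IsPolyShear (s t) t 0 := ⟨s_x t, by simp⟩

theorem isPolyShear_α_X_pow (n : ℕ) : IsPolyShear (α (RatFunc.X ^ n : RatFunc K)) 0 (X ^ n) :=
  ⟨by simp, by simp⟩

theorem X_pow_mem_degreeLT (n : ℕ) : (X ^ n : K[X]) ∈ degreeLT K (n + 1) := by
  rw [mem_degreeLT, degree_X_pow]
  exact_mod_cast n.lt_succ_self

theorem Γ_le_polyShearSubgroup (n : ℕ) : Γ K n ≤ polyShearSubgroup ⊤ (n + 1) := by
  rw [Γ, Subgroup.closure_le]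
  rintro _ (rfl | rfl)
  · exact ⟨1, trivial, 0, zero_mem _, isPolyShear_s 1⟩
  · exact ⟨0, trivial, X ^ n, X_pow_mem_degreeLT n, isPolyShear_α_X_pow n⟩

theorem lowerCentralSeries_Γ_le (n k : ℕ) (hk : k ≤ n) :
    (Γ K n).lowerCentralSeries (k + 1) ≤ polyShearSubgroup ⊥ (n - k) := by
  induction k with
  | zero =>
    rw [Subgroup.lowerCentralSeries_succ, Subgroup.commutator_le, Subgroup.lowerCentralSeries_zero]
    intro φ hφ ψ hψ
    obtain ⟨t, -, p, hp, hφ⟩ := Γ_le_polyShearSubgroup n hφ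
    obtain ⟨u, -, q, hq, hψ⟩ := Γ_le_polyShearSubgroup n hψ
    exact ⟨0, zero_mem _, _, taylor_mem_degreeLT (sub_mem (taylor_sub_mem_degreeLT hp u)
      (taylor_sub_mem_degreeLT hq t)) _, hφ.commutator hψ⟩
  | succ k ih =>
    rw [Subgroup.lowerCentralSeries_succ, Subgroup.commutator_le]
    intro φ hφ ψ hψ
    obtain ⟨t, ht, p, hp, hφ⟩ := ih (by omega) hφ
    obtain ⟨u, -, q, -, hψ⟩ := Γ_le_polyShearSubgroup n hψ
    obtain rfl := AddSubgroup.mem_bot.1 ht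
    rw [show n - k = n - (k + 1) + 1 by omega] at hp
    refine ⟨0, zero_mem _, _, taylor_mem_degreeLT (sub_mem (taylor_sub_mem_degreeLT hp u) ?_) _,
      hφ.commutator hψ⟩
    rw [taylor_zero, sub_self]
    exact zero_mem _

theorem lowerCentralSeries_Γ_eq_bot (n : ℕ) : (Γ K n).lowerCentralSeries (n + 1) = ⊥ := by
  rw [eq_bot_iff]
  intro φ hφ
  obtain ⟨t, ht, p, hp, hφ⟩ := lowerCentralSeries_Γ_le n n le_rfl hφ
  obtain rfl := AddSubgroup.mem_bot.1 ht
  obtain rfl : p = 0 := by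
    rw [mem_degreeLT, degree_lt_iff_coeff_zero] at hp
    ext m
    rw [hp m (by omega), coeff_zero]
  exact hφ.eq_one

/-- Commutation with `s₁` lowers the degree of a shear by one, so the `k`-fold commutator of
`α_{X^n}` with `s₁` is a shear by a polynomial of degree `n - k`. -/
theorem exists_mem_lowerCentralSeries_Γ [CharZero K] (n k : ℕ) (hk : k ≤ n) :
    ∃ φ ∈ (Γ K n).lowerCentralSeries k, ∃ p ∈ degreeLT K (n - k + 1),
      IsPolyShear φ 0 p ∧ p.coeff (n - k) ≠ 0 := by
  induction k with
  | zero =>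
    exact ⟨α (RatFunc.X ^ n), Subgroup.subset_closure (Or.inr rfl), X ^ n, X_pow_mem_degreeLT n,
      isPolyShear_α_X_pow n, by simp⟩
  | succ k ih =>
    obtain ⟨φ, hφ, p, hp, hφp, hp0⟩ := ih (by omega)
    rw [show n - k = n - (k + 1) + 1 by omega] at hp hp0
    set m := n - (k + 1)
    refine ⟨⁅φ, s 1⁆, ?_, _, ?_, hφp.commutator (isPolyShear_s 1), ?_⟩
    · rw [Subgroup.lowerCentralSeries_succ]
      exact Subgroup.commutator_mem_commutator hφ (Subgroup.subset_closure (Or.inl rfl))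
    · simpa using taylor_mem_degreeLT (taylor_sub_mem_degreeLT hp 1) _
    · rw [map_zero, sub_zero, sub_zero,
        coeff_taylor_eq_of_degreeLT (taylor_sub_mem_degreeLT hp 1) le_rfl, coeff_taylor_sub hp,
        mul_one]
      exact mul_ne_zero (Nat.cast_add_one_ne_zero m) hp0

theorem isNilpotent_Γ (n : ℕ) : Group.IsNilpotent (Γ K n) :=
  Subgroup.isNilpotent_of_lowerCentralSeries_eq_bot (lowerCentralSeries_Γ_eq_bot n)

theorem nilpotencyClass_Γ [CharZero K] (n : ℕ) : Group.nilpotencyClass (Γ K n) = n + 1 := by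
  have := isNilpotent_Γ (K := K) n
  have iff : ∀ k, Group.nilpotencyClass (Γ K n) ≤ k ↔ (Γ K n).lowerCentralSeries k = ⊥ := by
    intro k
    rw [← Subgroup.lowerCentralSeries_eq_bot_iff_nilpotencyClass_le,
      ← Subgroup.top_subtype_lowerCentralSeries (Γ K n),
      Subgroup.map_eq_bot_iff_of_injective _ (Γ K n).subtype_injective]
  refine le_antisymm ((iff _).2 (lowerCentralSeries_Γ_eq_bot n)) ?_
  by_contra! hlt
  have h := (iff n).1 (Nat.le_of_lt_succ hlt)
  obtain ⟨φ, hφ, p, -, hφp, hp⟩ := exists_mem_lowerCentralSeries_Γ (K := K) n n le_rfl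
  rw [h, Subgroup.mem_bot] at hφ
  subst hφ
  rw [(hφp.unique .one).2, coeff_zero] at hp
  exact hp rfl

theorem eq_one_of_mem_Γ_of_isOfFinOrder [CharZero K] {n : ℕ} {γ : Cr₂ K} (hγ : γ ∈ Γ K n)
    (h : IsOfFinOrder γ) : γ = 1 := by
  obtain ⟨t, -, p, -, hp⟩ := Γ_le_polyShearSubgroup n hγ
  exact hp.eq_one_of_isOfFinOrder h

theorem α_X_pow_succ_mul (n : ℕ) {m : Cr₂ K} (hmx : m.unop (x K) = x K)
    (hmy : m.unop (y K) = y K * x K) :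
    α (RatFunc.X ^ (n + 1) : RatFunc K) * m = m * α (RatFunc.X ^ n : RatFunc K) := by
  apply Cr₂.ext
  · rw [unop_mul_apply, unop_mul_apply, α_x, hmx, α_x]
  · simp only [unop_mul_apply, α_x, α_y, hmx, hmy, map_add, map_mul, map_pow, atX_X]
    rw [pow_succ, ← add_mul]

theorem Γ_le_G (n : ℕ) : Γ ℚ n ≤ G := by
  have hα : ∀ n : ℕ, α (RatFunc.X ^ n) ∈ G := by
    intro n
    induction n with
    | zero =>
      rw [pow_zero]
      exact Subgroup.subset_closure (Or.inr (Or.inl rfl))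
    | succ n ih =>
      have hm : μ (Units.mk0 RatFunc.X RatFunc.X_ne_zero) ∈ G :=
        Subgroup.subset_closure (Or.inr (Or.inr rfl))
      have e := α_X_pow_succ_mul (K := ℚ) n (μ_x _) muX_y
      rw [eq_mul_inv_of_mul_eq e]
      exact mul_mem (mul_mem hm ih) (inv_mem hm)
  rw [Γ, Subgroup.closure_le]
  rintro _ (rfl | rfl)
  · exact Subgroup.subset_closure (Or.inl rfl)
  · exact hα n

/-! ### Finite generation and non-linearity of `G` -/

theorem fg_G : Group.FG G := by
  rw [Group.fg_iff_subgroup_fg]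
  exact (Subgroup.fg_iff _).2 ⟨_, rfl, Set.toFinite _⟩

/-- A faithful representation of `G` would restrict to a faithful one of `Γ_n`, whose class
`n + 1` exceeds the dimension when `n` is that dimension. -/
theorem not_injective_representation_G {F : Type*} [Field F] {V : Type*} [AddCommGroup V]
    [Module F V] [FiniteDimensional F V] (ρ : Representation F G V) : ¬ Function.Injective ρ := by
  intro hρ
  set n := Module.finrank F V
  have := isNilpotent_Γ (K := ℚ) n
  have hN : ∀ g : Γ ℚ n, IsOfFinOrder g → g = 1 := fun g hg =>
    Subtype.ext (eq_one_of_mem_Γ_of_isOfFinOrder g.2 ((Γ ℚ n).subtype.isOfFinOrder hg))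
  have h := Representation.nilpotencyClass_le_finrank hN
    (ρ.comp (Subgroup.inclusion (Γ_le_G n)) : Representation F (Γ ℚ n) V)
    (hρ.comp (Subgroup.inclusion_injective _))
  rw [nilpotencyClass_Γ] at h
  exact absurd h (Nat.not_succ_le_self n)

end Cremona

theorem nilpotencyClass_subgroup_GL_le {F : Type*} [Field F] {d : ℕ}
    (H : Subgroup (Matrix.GeneralLinearGroup (Fin d) F)) (hH : ∀ h ∈ H, IsOfFinOrder h → h = 1)
    [Group.IsNilpotent H] : Group.nilpotencyClass H ≤ d :=
  nilpotencyClass_le_of_injective_matrix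
    (fun g hg => Subtype.ext (hH _ g.2 (H.subtype.isOfFinOrder hg)))
    ((Units.coeHom (Matrix (Fin d) (Fin d) F)).comp H.subtype)
    (Units.val_injective.comp H.subtype_injective)

theorem mainTheorem1 :
    -- `G` is finitely generated and solvable of derived length exactly three
    Group.FG Cremona.G ∧ Group.IsSolvable Cremona.G ∧
      IsLeast {k : ℕ | derivedSeries Cremona.G k = ⊥} 3 ∧
    -- `G` has no faithful finite-dimensional linear representation over any field
    (∀ (F : Type*) [Field F] (V : Type*) [AddCommGroup V] [Module F V] [FiniteDimensional F V]
      (ρ : Representation F Cremona.G V), ¬ Function.Injective ρ) ∧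
    -- `Γ_n` is a torsion-free nilpotent subgroup of `G`, of nilpotency class exactly `n + 1`
    (∀ n : ℕ, Cremona.Γ ℚ n ≤ Cremona.G ∧ (∀ γ ∈ Cremona.Γ ℚ n, IsOfFinOrder γ → γ = 1) ∧
      Group.IsNilpotent (Cremona.Γ ℚ n) ∧ Group.nilpotencyClass (Cremona.Γ ℚ n) = n + 1) ∧
    -- torsion-free nilpotent subgroups of `GL_d(F)` have class bounded in terms of `d` alone
    (∀ d : ℕ, ∃ c : ℕ, ∀ (F : Type*) [Field F] (H : Subgroup (Matrix.GeneralLinearGroup (Fin d) F)),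
      (∀ h ∈ H, IsOfFinOrder h → h = 1) → Group.IsNilpotent H → Group.nilpotencyClass H ≤ c) := by
  refine ⟨Cremona.fg_G, ⟨3, Cremona.derivedSeries_G_three⟩, Cremona.isLeast_derivedSeries_G,
    fun F _ V _ _ _ ρ => Cremona.not_injective_representation_G ρ, fun n => ⟨Cremona.Γ_le_G n,
      fun γ hγ => Cremona.eq_one_of_mem_Γ_of_isOfFinOrder hγ, Cremona.isNilpotent_Γ n,
      Cremona.nilpotencyClass_Γ n⟩, fun d => ⟨d, fun F _ H hH _ =>
      nilpotencyClass_subgroup_GL_le H hH⟩⟩
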